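/- Let $S$ be a finite semigroup and let $\mathbb B=\{0,1\}$ be the boolean semiring ($1+1=1$). A $\mathbb BS$-module is a right module $M$ over the (not necessarily unital) semigroup algebra $\mathbb BS$. A congruence on $M$ is an equivalence relation compatible with addition, scalars and the action; it is proper if it has more than one class and trivial if all its classes are singletons. If $M\cdot\mathbb BS\neq 0$, then $M$ is called simple if every proper congruence on it is trivial, minimal if its only submodules are $0$ and $M$, and irreducible if it is both simple and minimal. Let $J$ be a regular $\mathscr J$-class of $S$ (one containing an idempotent), with set $A$ of $\mathscr R$-classes and set $B$ of $\mathscr L$-classes. Let $\mathbb BB$ be the free $\mathbb B$-module on $B$ with the right action of $S$ under which $b\cdot s=bs$ (the $\mathscr L$-class of $xs$ for $x\in b$) if $bs\subseteq J$, and $b\cdot s=0$ otherwise. For $m,n\in\mathbb BB$ put $m\equiv n$ if, for all $s\in S$, $ms=0\iff ns=0$; this is a congruence. Let $C\colon B\times A\to\mathbb B$ be the matrix with $C_{ba}=1$ if and only if $a\cap b$ contains an idempotent. Let $S$ act on the right of the module $\mathbb B^A$ of row vectors by $(fs)(a)=f(sa)$ if $sa\subseteq J$ and $(fs)(a)=0$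 otherwise, where $sa$ denotes the $\mathscr R$-class of $sx$ for $x\in a$. Then: 1. The congruence $\equiv$ is the unique maximal proper congruence on $\mathbb BB$. 2. The module $\mathbb BB$ is minimal, as is its quotient by every proper congruence. 3. The module $\mathbb BB/{\equiv}$ is irreducible. It has apex $J$, that is, the set of elements of $S$ annihilating it is $\{s\in S\mid J\not\subseteq S^1sS^1\}$, and every irreducible $\mathbb BS$-module with apex $J$ is isomorphic to it. 4. There is an injective homomorphism of $\mathbb BS$-modules $\mathbb BB/{\equiv}\to\mathbb B^A$ that sends the class of each $b\in B$ to the row of $C$ indexed by $b$; its image is the $\mathbb B$-span of the rows of $C$. Moreover, every irreducible $\mathbb BS$-module is isomorphic to $\mathbb BB/{\equiv}$ for exactly one regular $\mathscr J$-class $J$, and every minimal $\mathbb BS$-module is isomorphic to the quotient of $\mathbb BB$ by a proper congruence, for some regular $\mathscr J$-class $J$. -/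

import Mathlib

universe u v w

/-! ### The boolean semiring -/

/-- The two-element boolean semiring `{0, 1}`: addition is "or" (so `1 + 1 = 1`), multiplication
is "and". (The instances on `Bool` itself make it the field with two elements, hence the new
type.) -/
def BoolSemiring : Type := Bool

namespace BoolSemiring

instance : DecidableEq BoolSemiring := inferInstanceAs (DecidableEq Bool)

instance : Fintype BoolSemiring := inferInstanceAs (Fintype Bool)

instance : Zero BoolSemiring := ⟨false⟩

instance : One BoolSemiring := ⟨true⟩

instance : Add BoolSemiring := ⟨or⟩

instance : Mul BoolSemiring := ⟨and⟩

instance : CommSemiring BoolSemiring where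
  add_assoc := by decide
  zero_add := by decide
  add_zero := by decide
  add_comm := by decide
  mul_assoc := by decide
  one_mul := by decide
  mul_one := by decide
  zero_mul := by decide
  mul_zero := by decide
  mul_comm := by decide
  left_distrib := by decide
  right_distrib := by decide
  nsmul := nsmulRec
  npow := npowRec

theorem one_add_one : (1 + 1 : BoolSemiring) = 1 := rfl

/-- In a module over the boolean semiring a sum vanishes only if both summands do. -/
theorem add_eq_zero {M : Type w} [AddCommMonoid M] [Module BoolSemiring M] {x y : M} :
    x + y = 0 ↔ x = 0 ∧ y = 0 := by
  have idem : ∀ z : M, z + z = z := fun z => by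
    have h := add_smul (1 : BoolSemiring) 1 z
    rw [one_add_one, one_smul] at h
    exact h.symm
  constructor
  · intro h
    have hx : x = 0 := by
      calc x = x + (x + y) := by rw [h, add_zero]
        _ = x + y := by rw [← add_assoc, idem]
        _ = 0 := h
    refine ⟨hx, ?_⟩
    rwa [hx, zero_add] at h
  · rintro ⟨rfl, rfl⟩
    exact add_zero 0

end BoolSemiring

/-! ### Right modules over a (not necessarily unital) algebra -/

section Modules

variable {k : Type*} [CommSemiring k] {A : Type*} [NonUnitalSemiring A] [Module k A]

/-- A right `A`-module structure on the `k`-module `M`, for a not necessarily unital `k`-algebra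
`A`, given as a homomorphism from `A` to the opposite of the endomorphism algebra of `M`. -/
abbrev RightModule (k : Type*) [CommSemiring k] (A : Type*) [NonUnitalSemiring A] [Module k A]
    (M : Type*) [AddCommMonoid M] [Module k M] :=
  A →ₙₐ[k] (Module.End k M)ᵐᵒᵖ

namespace RightModule

variable {M : Type*} [AddCommMonoid M] [Module k M] {N : Type*} [AddCommMonoid N] [Module k N]

/-- The action `m ↦ m · a`. -/
def act (ρ : RightModule k A M) (m : M) (a : A) : M := (ρ a).unop m

/-- `M A ≠ 0`. -/
def IsNonNull (ρ : RightModule k A M) : Prop := ∃ m a, ρ.act m a ≠ 0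

/-- A `k`-submodule that is closed under the action of `A`, i.e. an `A`-submodule. -/
def IsSubmodule (ρ : RightModule k A M) (P : Submodule k M) : Prop :=
  ∀ m ∈ P, ∀ a, ρ.act m a ∈ P

/-- Congruences of right `A`-modules: equivalence relations that are compatible with addition,
with the scalars and with the action of `A`. -/
structure Congruence (ρ : RightModule k A M) extends ModuleCon k M where
  act_compat : ∀ (a : A) {x y : M}, r x y → r (ρ.act x a) (ρ.act y a)

namespace Congruence

variable {ρ : RightModule k A M}

/-- A congruence is proper if it has more than one class. -/
def IsProper (R : Congruence ρ) : Prop := ∃ x y, ¬ R.r x y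

/-- A congruence is trivial if its classes are singletons. -/
def IsTrivial (R : Congruence ρ) : Prop := ∀ x y, R.r x y → x = y

/-- A maximal element of the set of proper congruences, ordered by inclusion. -/
def IsMaximal (R : Congruence ρ) : Prop :=
  R.IsProper ∧ ∀ T : Congruence ρ, T.IsProper → (∀ x y, R.r x y → T.r x y) → T = R

/-- The underlying type of the quotient module. -/
abbrev Quot (R : Congruence ρ) : Type _ := R.toModuleCon.Quotient

/-- The quotient map. -/
def toQuot (R : Congruence ρ) (m : M) : R.Quot := Quotient.mk R.toSetoid m

/-- The right module structure of the quotient: `[m] · a = [m · a]`. -/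
def quotient (R : Congruence ρ) : RightModule k A R.Quot where
  toFun a := MulOpposite.op
    { toFun := Quotient.map (fun m => ρ.act m a) (fun _ _ h => R.act_compat a h)
      map_add' := by
        rintro ⟨x⟩ ⟨y⟩
        exact congrArg R.toQuot (map_add (ρ a).unop x y)
      map_smul' := by
        rintro c ⟨x⟩
        exact congrArg R.toQuot (map_smul (ρ a).unop c x) }
  map_smul' c a := by
    apply MulOpposite.unop_injective
    ext ⟨x⟩
    refine congrArg R.toQuot (?_ : (ρ (c • a)).unop x = c • (ρ a).unop x)
    rw [map_smul]; rfl
  map_zero' := by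
    apply MulOpposite.unop_injective
    ext ⟨x⟩
    refine congrArg R.toQuot (?_ : (ρ 0).unop x = 0)
    rw [map_zero]; rfl
  map_add' a b := by
    apply MulOpposite.unop_injective
    ext ⟨x⟩
    refine congrArg R.toQuot (?_ : (ρ (a + b)).unop x = (ρ a).unop x + (ρ b).unop x)
    rw [map_add]; rfl
  map_mul' a b := by
    apply MulOpposite.unop_injective
    ext ⟨x⟩
    refine congrArg R.toQuot (?_ : (ρ (a * b)).unop x = (ρ b).unop ((ρ a).unop x))
    rw [map_mul]; rfl

end Congruence

/-- A right module with `M A ≠ 0` is simple if it has only trivial quotients, i.e. if each of its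
congruences is either trivial or not proper. -/
def IsSimple (ρ : RightModule k A M) : Prop :=
  ρ.IsNonNull ∧ ∀ R : Congruence ρ, R.IsProper → R.IsTrivial

/-- A right module with `M A ≠ 0` is minimal if it has no proper non-zero submodules. -/
def IsMinimal (ρ : RightModule k A M) : Prop :=
  ρ.IsNonNull ∧ ∀ P : Submodule k M, ρ.IsSubmodule P → P = ⊥ ∨ P = ⊤

/-- A right module is irreducible if it is both simple and minimal. -/
def IsIrreducible (ρ : RightModule k A M) : Prop := ρ.IsSimple ∧ ρ.IsMinimal

/-- A `k`-linear map is a homomorphism of right `A`-modules if it commutes with the actions. -/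
def IsHom (ρ : RightModule k A M) (σ : RightModule k A N) (f : M →ₗ[k] N) : Prop :=
  ∀ m a, f (ρ.act m a) = σ.act (f m) a

/-- Isomorphism of right `A`-modules. -/
def Isomorphic (ρ : RightModule k A M) (σ : RightModule k A N) : Prop :=
  ∃ f : M ≃ₗ[k] N, IsHom ρ σ f.toLinearMap

end RightModule

end Modules

/-! ### Green's relations -/

section Green

variable (S : Type u) [Semigroup S]

variable {S} in
/-- The principal left ideal `S¹ s`. -/
def leftIdeal (s : S) : Set S := {t | ∃ x : WithOne S, (t : WithOne S) = x * s}

variable {S} in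
/-- The principal right ideal `s S¹`. -/
def rightIdeal (s : S) : Set S := {t | ∃ y : WithOne S, (t : WithOne S) = s * y}

variable {S} in
/-- The principal two-sided ideal `S¹ s S¹`. -/
def principalIdeal (s : S) : Set S := {t | ∃ x y : WithOne S, (t : WithOne S) = x * s * y}

/-- Green's relation `L`: generating the same principal left ideal. -/
def greenL : Setoid S := Setoid.ker leftIdeal

/-- Green's relation `R`: generating the same principal right ideal. -/
def greenR : Setoid S := Setoid.ker rightIdeal

/-- Green's relation `J`: generating the same principal two-sided ideal. -/
def greenJ : Setoid S := Setoid.ker principalIdeal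

variable {S}

theorem mem_leftIdeal_self (s : S) : s ∈ leftIdeal s := ⟨1, by simp⟩

theorem mem_rightIdeal_self (s : S) : s ∈ rightIdeal s := ⟨1, by simp⟩

theorem mem_principalIdeal_self (s : S) : s ∈ principalIdeal s := ⟨1, 1, by simp⟩

theorem principalIdeal_subset {s t : S} (h : s ∈ principalIdeal t) :
    principalIdeal s ⊆ principalIdeal t := by
  rintro r ⟨x, y, hr⟩
  obtain ⟨x', y', hs⟩ := h
  exact ⟨x * x', y' * y, by rw [hr, hs]; simp only [mul_assoc]⟩

theorem leftIdeal_subset {s t : S} (h : s ∈ leftIdeal t) : leftIdeal s ⊆ leftIdeal t := by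
  rintro r ⟨x, hr⟩
  obtain ⟨x', hs⟩ := h
  exact ⟨x * x', by rw [hr, hs, mul_assoc]⟩

theorem rightIdeal_subset {s t : S} (h : s ∈ rightIdeal t) : rightIdeal s ⊆ rightIdeal t := by
  rintro r ⟨x, hr⟩
  obtain ⟨x', hs⟩ := h
  exact ⟨x' * x, by rw [hr, hs, mul_assoc]⟩

theorem leftIdeal_subset_principalIdeal (s : S) : leftIdeal s ⊆ principalIdeal s := by
  rintro r ⟨x, hr⟩
  exact ⟨x, 1, by rw [hr, mul_one]⟩

theorem rightIdeal_subset_principalIdeal (s : S) : rightIdeal s ⊆ principalIdeal s := by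
  rintro r ⟨y, hr⟩
  exact ⟨1, y, by rw [hr, one_mul]⟩

theorem mul_right_mem_principalIdeal (s t : S) : s * t ∈ principalIdeal s :=
  ⟨1, t, by simp⟩

theorem mul_left_mem_principalIdeal (s t : S) : t * s ∈ principalIdeal s :=
  ⟨t, 1, by simp⟩

theorem greenL_le_greenJ {s t : S} (h : (greenL S).r s t) : (greenJ S).r s t := by
  have h' : leftIdeal s = leftIdeal t := h
  have h1 : s ∈ leftIdeal t := h' ▸ mem_leftIdeal_self s
  have h2 : t ∈ leftIdeal s := h' ▸ mem_leftIdeal_self t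
  exact Set.Subset.antisymm
    (principalIdeal_subset (leftIdeal_subset_principalIdeal t h1))
    (principalIdeal_subset (leftIdeal_subset_principalIdeal s h2))

theorem greenR_le_greenJ {s t : S} (h : (greenR S).r s t) : (greenJ S).r s t := by
  have h' : rightIdeal s = rightIdeal t := h
  have h1 : s ∈ rightIdeal t := h' ▸ mem_rightIdeal_self s
  have h2 : t ∈ rightIdeal s := h' ▸ mem_rightIdeal_self t
  exact Set.Subset.antisymm
    (principalIdeal_subset (rightIdeal_subset_principalIdeal t h1))
    (principalIdeal_subset (rightIdeal_subset_principalIdeal s h2))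

theorem greenL_mul_right (r : S) {s t : S} (h : (greenL S).r s t) :
    (greenL S).r (s * r) (t * r) := by
  have h' : leftIdeal s = leftIdeal t := h
  obtain ⟨x, hx⟩ : s ∈ leftIdeal t := h' ▸ mem_leftIdeal_self s
  obtain ⟨y, hy⟩ : t ∈ leftIdeal s := h' ▸ mem_leftIdeal_self t
  exact Set.Subset.antisymm
    (leftIdeal_subset ⟨x, by rw [WithOne.coe_mul, hx, WithOne.coe_mul, mul_assoc]⟩)
    (leftIdeal_subset ⟨y, by rw [WithOne.coe_mul, hy, WithOne.coe_mul, mul_assoc]⟩)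

theorem greenR_mul_left (r : S) {s t : S} (h : (greenR S).r s t) :
    (greenR S).r (r * s) (r * t) := by
  have h' : rightIdeal s = rightIdeal t := h
  obtain ⟨x, hx⟩ : s ∈ rightIdeal t := h' ▸ mem_rightIdeal_self s
  obtain ⟨y, hy⟩ : t ∈ rightIdeal s := h' ▸ mem_rightIdeal_self t
  exact Set.Subset.antisymm
    (rightIdeal_subset ⟨x, by rw [WithOne.coe_mul, hx, WithOne.coe_mul, mul_assoc]⟩)
    (rightIdeal_subset ⟨y, by rw [WithOne.coe_mul, hy, WithOne.coe_mul, mul_assoc]⟩)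

/-- The `L`-class of an element. -/
def classL (s : S) : Quotient (greenL S) := Quotient.mk _ s

/-- The `R`-class of an element. -/
def classR (s : S) : Quotient (greenR S) := Quotient.mk _ s

/-- The `J`-class of an element. -/
def classJ (s : S) : Quotient (greenJ S) := Quotient.mk _ s

/-- The `J`-class that contains a given `L`-class. -/
def jOfL (b : Quotient (greenL S)) : Quotient (greenJ S) :=
  Quotient.map id (fun _ _ h => greenL_le_greenJ h) b

/-- The `J`-class that contains a given `R`-class. -/
def jOfR (a : Quotient (greenR S)) : Quotient (greenJ S) :=
  Quotient.map id (fun _ _ h => greenR_le_greenJ h) a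

/-- Right multiplication on `L`-classes: the class of `x` goes to the class of `x s`. -/
def mulL (b : Quotient (greenL S)) (s : S) : Quotient (greenL S) :=
  Quotient.map (· * s) (fun _ _ h => greenL_mul_right s h) b

/-- Left multiplication on `R`-classes: the class of `x` goes to the class of `s x`. -/
def mulR (s : S) (a : Quotient (greenR S)) : Quotient (greenR S) :=
  Quotient.map (s * ·) (fun _ _ h => greenR_mul_left s h) a

variable (S) in
/-- The regular `J`-classes, i.e. those that contain an idempotent. -/
abbrev RegularJClass : Type u :=
  {j : Quotient (greenJ S) // ∃ e : S, IsIdempotentElem e ∧ classJ e = j}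

/-- The set of `R`-classes contained in `J`. -/
abbrev RClasses (J : RegularJClass S) : Type u := {a : Quotient (greenR S) // jOfR a = J.1}

/-- The set of `L`-classes contained in `J`. -/
abbrev LClasses (J : RegularJClass S) : Type u := {b : Quotient (greenL S) // jOfL b = J.1}

theorem mulL_mul (b : Quotient (greenL S)) (s t : S) :
    mulL b (s * t) = mulL (mulL b s) t := by
  induction b using Quotient.inductionOn with
  | h x => exact congrArg classL (mul_assoc x s t).symm

theorem mulR_mul (s t : S) (a : Quotient (greenR S)) :
    mulR (s * t) a = mulR s (mulR t a) := by
  induction a using Quotient.inductionOn with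
  | h x => exact congrArg classR (mul_assoc s t x)

/-- If `x` and `x s t` lie in the same `J`-class then so does `x s`. -/
theorem jOfL_mulL_of_mul {b : Quotient (greenL S)} {s t : S}
    (h : jOfL (mulL (mulL b s) t) = jOfL b) : jOfL (mulL b s) = jOfL b := by
  induction b using Quotient.inductionOn with
  | h x =>
    have h' : principalIdeal (x * s * t) = principalIdeal x := Quotient.exact h
    refine Quotient.sound (s := greenJ S) (Set.Subset.antisymm
      (principalIdeal_subset (mul_right_mem_principalIdeal x s)) ?_)
    change principalIdeal x ⊆ principalIdeal (x * s)
    rw [← h']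
    exact principalIdeal_subset (mul_right_mem_principalIdeal (x * s) t)

/-- If `x` and `s t x` lie in the same `J`-class then so does `t x`. -/
theorem jOfR_mulR_of_mul {a : Quotient (greenR S)} {s t : S}
    (h : jOfR (mulR s (mulR t a)) = jOfR a) : jOfR (mulR t a) = jOfR a := by
  induction a using Quotient.inductionOn with
  | h x =>
    have h' : principalIdeal (s * (t * x)) = principalIdeal x := Quotient.exact h
    refine Quotient.sound (s := greenJ S) (Set.Subset.antisymm
      (principalIdeal_subset (mul_left_mem_principalIdeal x t)) ?_)
    change principalIdeal x ⊆ principalIdeal (t * x)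
    rw [← h']
    exact principalIdeal_subset (mul_left_mem_principalIdeal (t * x) s)

end Green

/-! ### Boolean modules of a semigroup -/

noncomputable section BooleanModules

variable {S : Type u} [Semigroup S]

/-- Right modules over the semigroup algebra `𝔹S` of `S` over the boolean semiring `𝔹`. -/
abbrev BoolModule (S : Type u) [Semigroup S] (M : Type w) [AddCommMonoid M]
    [Module BoolSemiring M] :=
  RightModule BoolSemiring (MonoidAlgebra BoolSemiring S) M

namespace BoolModule

variable {M : Type w} [AddCommMonoid M] [Module BoolSemiring M]

/-- The action `m ↦ m · s` of an element `s` of the semigroup. -/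
def sact (ρ : BoolModule S M) (m : M) (s : S) : M := ρ.act m (MonoidAlgebra.single s 1)

/-- The relation `m ≡ n` iff `m s = 0 ↔ n s = 0` for all `s` in `S`. -/
def NullEquiv (ρ : BoolModule S M) (m n : M) : Prop := ∀ s : S, ρ.sact m s = 0 ↔ ρ.sact n s = 0

/-- `J` is the apex of `M`: the set of elements of `S` that annihilate `M` is
`{s ∈ S | J ⊈ S¹ s S¹}`. -/
def HasApex (ρ : BoolModule S M) (J : RegularJClass S) : Prop :=
  {s : S | ∀ m : M, ρ.sact m s = 0} = {s : S | ¬ {x : S | classJ x = J.1} ⊆ principalIdeal s}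

theorem sact_add (ρ : BoolModule S M) (m n : M) (s : S) :
    ρ.sact (m + n) s = ρ.sact m s + ρ.sact n s :=
  map_add (ρ (MonoidAlgebra.single s 1)).unop m n

theorem act_add (ρ : BoolModule S M) (m : M) (a b : MonoidAlgebra BoolSemiring S) :
    ρ.act m (a + b) = ρ.act m a + ρ.act m b := by
  simp only [RightModule.act, map_add]; rfl

theorem act_smul (ρ : BoolModule S M) (m : M) (c : BoolSemiring)
    (a : MonoidAlgebra BoolSemiring S) : ρ.act m (c • a) = c • ρ.act m a := by
  simp only [RightModule.act, map_smul]; rfl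

theorem act_zero (ρ : BoolModule S M) (m : M) : ρ.act m 0 = 0 := by
  simp only [RightModule.act, map_zero]; rfl

theorem act_mul (ρ : BoolModule S M) (m : M) (a b : MonoidAlgebra BoolSemiring S) :
    ρ.act m (a * b) = ρ.act (ρ.act m a) b := by
  simp only [RightModule.act, map_mul]; rfl

theorem zero_act (ρ : BoolModule S M) (a : MonoidAlgebra BoolSemiring S) :
    ρ.act 0 a = 0 := map_zero (ρ a).unop

theorem zero_or_one (c : BoolSemiring) : c = 0 ∨ c = 1 := by
  revert c; decide

/-- The relation `≡` as a congruence of right `𝔹S`-modules. -/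
def nullCongruence (ρ : BoolModule S M) : RightModule.Congruence ρ where
  r := ρ.NullEquiv
  iseqv := ⟨fun _ _ => Iff.rfl, fun h s => (h s).symm, fun h h' s => (h s).trans (h' s)⟩
  add' := by
    intro x x' y y' h h' s
    rw [sact_add, sact_add, BoolSemiring.add_eq_zero, BoolSemiring.add_eq_zero, h s, h' s]
  smul := by
    intro c x y h s
    rcases zero_or_one c with rfl | rfl
    · rw [zero_smul, zero_smul]
    · rw [one_smul, one_smul]; exact h s
  act_compat := by
    intro a x y h
    induction a using MonoidAlgebra.induction_linear with
    | zero => intro s; rw [act_zero, act_zero]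
    | add a b ha hb =>
      intro s
      rw [act_add, act_add, sact_add, sact_add, BoolSemiring.add_eq_zero,
        BoolSemiring.add_eq_zero, ha s, hb s]
    | single t c =>
      intro s
      rcases zero_or_one c with rfl | rfl
      · rw [MonoidAlgebra.single_zero, act_zero, act_zero]
      · simp only [sact]
        rw [← act_mul, ← act_mul, MonoidAlgebra.single_mul_single, one_mul]
        exact h (t * s)

end BoolModule

open Classical in
/-- The endomorphism of the free module `𝔹B` on the set `B` of `L`-classes of `J` by which `s`
acts: the basis vector `b` is sent to the basis vector `b s` if `b s ⊆ J`, and to `0` otherwise. -/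
def freeAct (J : RegularJClass S) (s : S) : Module.End BoolSemiring (LClasses J →₀ BoolSemiring) :=
  Finsupp.linearCombination BoolSemiring fun b : LClasses J =>
    if h : jOfL (mulL b.1 s) = J.1 then
      Finsupp.single (⟨mulL b.1 s, h⟩ : LClasses J) (1 : BoolSemiring) else 0

open Classical in
theorem freeAct_mul (J : RegularJClass S) (s t : S) :
    freeAct J (s * t) = freeAct J t * freeAct J s := by
  refine Finsupp.lhom_ext' fun b => LinearMap.ext_ring ?_
  change freeAct J (s * t) (Finsupp.single b 1) = freeAct J t (freeAct J s (Finsupp.single b 1))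
  simp only [freeAct, Finsupp.linearCombination_single, one_smul]
  by_cases h : jOfL (mulL b.1 s) = J.1
  · rw [dif_pos h, Finsupp.linearCombination_single, one_smul]
    exact dite_congr (by rw [mulL_mul]) (fun _ => by simp only [mulL_mul]) fun _ => rfl
  · rw [dif_neg h, map_zero, dif_neg]
    intro h'
    rw [mulL_mul] at h'
    exact h ((jOfL_mulL_of_mul (h'.trans b.2.symm)).trans b.2)

/-- The free boolean module `𝔹B` on the set `B` of `L`-classes of `J`, with its natural right
action of `S`, as a right `𝔹S`-module. -/
def freeLModule (J : RegularJClass S) : BoolModule S (LClasses J →₀ BoolSemiring) :=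
  MonoidAlgebra.liftMagma BoolSemiring
    { toFun := fun s => MulOpposite.op (freeAct J s)
      map_mul' := fun s t => congrArg MulOpposite.op (freeAct_mul J s t) }

open Classical in
/-- The endomorphism of the module `𝔹^A` of row vectors indexed by the set `A` of `R`-classes of
`J` by which `s` acts: `(f s)(a) = f (s a)` if `s a ⊆ J`, and `(f s)(a) = 0` otherwise. -/
def rowAct (J : RegularJClass S) (s : S) : Module.End BoolSemiring (RClasses J → BoolSemiring) where
  toFun f a := if h : jOfR (mulR s a.1) = J.1 then f ⟨mulR s a.1, h⟩ else 0
  map_add' f g := by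
    funext a
    by_cases h : jOfR (mulR s a.1) = J.1 <;> simp [h]
  map_smul' c f := by
    funext a
    by_cases h : jOfR (mulR s a.1) = J.1 <;> simp [h]

open Classical in
theorem rowAct_mul (J : RegularJClass S) (s t : S) :
    rowAct J (s * t) = rowAct J t * rowAct J s := by
  refine LinearMap.ext fun f => funext fun a => ?_
  change rowAct J (s * t) f a = rowAct J t (rowAct J s f) a
  simp only [rowAct, LinearMap.coe_mk, AddHom.coe_mk]
  by_cases h : jOfR (mulR t a.1) = J.1
  · rw [dif_pos h]
    exact dite_congr (by rw [mulR_mul]) (fun _ => by simp only [mulR_mul]) fun _ => rfl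
  · rw [dif_neg h, dif_neg]
    intro h'
    rw [mulR_mul] at h'
    exact h ((jOfR_mulR_of_mul (h'.trans a.2.symm)).trans a.2)

/-- The module `𝔹^A` of row vectors indexed by the set `A` of `R`-classes of `J`, as a right
`𝔹S`-module. -/
def rowModule (J : RegularJClass S) : BoolModule S (RClasses J → BoolSemiring) :=
  MonoidAlgebra.liftMagma BoolSemiring
    { toFun := fun s => MulOpposite.op (rowAct J s)
      map_mul' := fun s t => congrArg MulOpposite.op (rowAct_mul J s t) }

open Classical in
/-- The idempotent-incidence matrix: `C b a = 1` iff the `H`-class `a ∩ b` contains an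
idempotent. -/
def incidenceMatrix (J : RegularJClass S) : Matrix (LClasses J) (RClasses J) BoolSemiring :=
  fun b a => if ∃ e : S, IsIdempotentElem e ∧ classR e = a.1 ∧ classL e = b.1 then 1 else 0

/-- The congruence `≡` on `𝔹B`: `m ≡ n` iff `m s = 0 ↔ n s = 0` for all `s` in `S`. -/
def freeCongruence (J : RegularJClass S) : RightModule.Congruence (freeLModule J) :=
  BoolModule.nullCongruence (freeLModule J)

/-- The quotient module `𝔹B/≡`. -/
def quotientModule (J : RegularJClass S) : BoolModule S (freeCongruence J).Quot :=
  (freeCongruence J).quotient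

end BooleanModules

/-! ### Green's relations through factorizations in `WithOne S`. -/

section GreenLemmas

variable {S : Type u} [Semigroup S]

/-! Everything rests on one feature of boolean modules: a sum vanishes only if every summand does.
In a minimal module the class of 0 under a proper congruence is a submodule other than the whole
module, hence {0}. So congruent elements are annihilated by the same `s`, and `≡` contains every
proper congruence (`le_nullCongruence`).

The module `𝔹B` is minimal because an `s` in `J` sends every vector to 0 or to the basis vector of
its own `L`-class, and `J` acts transitively on `B`.

A minimal module `M` has an apex: among the elements not annihilating `M`, one with a smallest
principal ideal generates it, and the Clifford–Miller theorem (`classJ_mul_eq_iff`) makes its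
`J`-class regular. If `m x ≠ 0` with `x` in the apex `J`, then `b ↦ ∑ m y`, over `y` in `b`, is a
nonzero homomorphism `𝔹B → M` (`exists_hom_of_hasApex`): right multiplication by `s` maps `b` onto
`b s` or out of `J`, and repeated summands are absorbed. By minimality it is onto, and if `M` is
simple its kernel congruence is `≡`.

By Clifford–Miller again, `C b a = 1` exactly when `b x` stays in `J` for `x` in `a`. Hence taking
rows is a homomorphism, and its kernel congruence is `≡`. -/

theorem WithOne.exists_coe_eq_mul_coe (p : WithOne S) (x : S) :
    ∃ y : S, (y : WithOne S) = p * x := by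
  rcases p with _ | a
  · exact ⟨x, (one_mul _).symm⟩
  · exact ⟨a * x, WithOne.coe_mul a x⟩

theorem WithOne.exists_coe_eq_coe_mul (x : S) (p : WithOne S) :
    ∃ y : S, (y : WithOne S) = x * p := by
  rcases p with _ | a
  · exact ⟨x, (mul_one _).symm⟩
  · exact ⟨x * a, WithOne.coe_mul x a⟩

theorem classJ_eq_iff {s t : S} :
    classJ s = classJ t ↔ s ∈ principalIdeal t ∧ t ∈ principalIdeal s := by
  constructor
  · intro h
    have h' : principalIdeal s = principalIdeal t := Quotient.exact h
    exact ⟨h' ▸ mem_principalIdeal_self s, h' ▸ mem_principalIdeal_self t⟩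
  · rintro ⟨h, h'⟩
    exact Quotient.sound (s := greenJ S)
      (Set.Subset.antisymm (principalIdeal_subset h) (principalIdeal_subset h'))

theorem classL_eq_iff {s t : S} :
    classL s = classL t ↔ s ∈ leftIdeal t ∧ t ∈ leftIdeal s := by
  constructor
  · intro h
    have h' : leftIdeal s = leftIdeal t := Quotient.exact h
    exact ⟨h' ▸ mem_leftIdeal_self s, h' ▸ mem_leftIdeal_self t⟩
  · rintro ⟨h, h'⟩
    exact Quotient.sound (s := greenL S)
      (Set.Subset.antisymm (leftIdeal_subset h) (leftIdeal_subset h'))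

theorem classR_eq_iff {s t : S} :
    classR s = classR t ↔ s ∈ rightIdeal t ∧ t ∈ rightIdeal s := by
  constructor
  · intro h
    have h' : rightIdeal s = rightIdeal t := Quotient.exact h
    exact ⟨h' ▸ mem_rightIdeal_self s, h' ▸ mem_rightIdeal_self t⟩
  · rintro ⟨h, h'⟩
    exact Quotient.sound (s := greenR S)
      (Set.Subset.antisymm (rightIdeal_subset h) (rightIdeal_subset h'))

theorem principalIdeal_trans {r s t : S} (h : r ∈ principalIdeal s) (h' : s ∈ principalIdeal t) :
    r ∈ principalIdeal t :=
  principalIdeal_subset h' h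

/-- The elements whose principal ideal contains a `J`-class are those above it. -/
theorem setOf_classJ_subset_iff {x s : S} :
    {y : S | classJ y = classJ x} ⊆ principalIdeal s ↔ x ∈ principalIdeal s :=
  ⟨fun h => h rfl, fun h _ hy => principalIdeal_trans (classJ_eq_iff.1 hy).1 h⟩

theorem classJ_eq_of_mul_left {x s t : S} (h : classJ (s * (t * x)) = classJ x) :
    classJ (t * x) = classJ x :=
  jOfR_mulR_of_mul (a := classR x) (s := s) (t := t) h

/-- Each element above a regular `J`-class sends some `L`-class of it into it. -/
theorem exists_jOfL_mulL_eq (J : RegularJClass S) {x s : S} (hx : classJ x = J.1)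
    (hs : x ∈ principalIdeal s) : ∃ b : LClasses J, jOfL (mulL b.1 s) = J.1 := by
  obtain ⟨j, e, he, rfl⟩ := J
  obtain ⟨p, q, hpq⟩ := principalIdeal_trans (classJ_eq_iff.1 hx).2 hs
  -- The factor `e` keeps `z = e p` below `J`, while `e = e e = (z s) q` puts both `z s` and `z`
  -- above it.
  obtain ⟨z, hz⟩ := WithOne.exists_coe_eq_coe_mul e p
  have h1 : e ∈ principalIdeal (z * s) := by
    refine ⟨1, q, ?_⟩
    rw [one_mul, WithOne.coe_mul, hz]
    calc (e : WithOne S) = e * e := by rw [← WithOne.coe_mul, he.eq]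
      _ = e * (p * s * q) := by rw [← hpq]
      _ = _ := by simp only [mul_assoc]
  have h2 : z ∈ principalIdeal e := rightIdeal_subset_principalIdeal e ⟨p, hz⟩
  have h3 : z * s ∈ principalIdeal z := mul_right_mem_principalIdeal z s
  exact ⟨⟨classL z, classJ_eq_iff.2 ⟨h2, principalIdeal_trans h1 h3⟩⟩,
    classJ_eq_iff.2 ⟨principalIdeal_trans h3 h2, h1⟩⟩

/-! ### Stability and regular `J`-classes in finite semigroups. -/

variable [Finite S]

theorem exists_pow_isIdempotentElem_of_finite {G : Type*} [Monoid G] [Finite G] (w : G) :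
    ∃ n : ℕ, IsIdempotentElem (w ^ (n + 1)) := by
  obtain ⟨i, j, hne, hij⟩ := Finite.exists_ne_map_eq_of_infinite (fun n : ℕ => w ^ n)
  wlog hlt : i < j generalizing i j
  · exact this j i hne.symm hij.symm (lt_of_le_of_ne (not_lt.1 hlt) hne.symm)
  obtain ⟨d, rfl⟩ := Nat.exists_eq_add_of_lt hlt
  -- From the exponent `i` on, the powers of `w` have period `d + 1`.
  have step : ∀ c k : ℕ, i ≤ k → w ^ (k + c * (d + 1)) = w ^ k := by
    intro c
    induction c with
    | zero => intro k _; simp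
    | succ c ih =>
      intro k hk
      have h1 : w ^ (k + (d + 1)) = w ^ k := by
        obtain ⟨l, rfl⟩ := Nat.exists_eq_add_of_le hk
        have h2 : w ^ (i + d + 1) = w ^ i := hij.symm
        calc w ^ (i + l + (d + 1)) = w ^ (i + d + 1) * w ^ l := by rw [← pow_add]; congr 1; ring
          _ = w ^ (i + l) := by rw [h2, pow_add]
      calc w ^ (k + (c + 1) * (d + 1)) = w ^ ((k + (d + 1)) + c * (d + 1)) := by
            congr 1; ring
        _ = w ^ (k + (d + 1)) := ih _ (by omega)
        _ = w ^ k := h1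
  -- The exponent `(i + 1) * (d + 1)` is a multiple of the period and at least `i`, so doubling it
  -- does not change the power.
  refine ⟨(i + 1) * (d + 1) - 1, ?_⟩
  have hpos : 1 ≤ (i + 1) * (d + 1) := Nat.mul_pos (Nat.succ_pos _) (Nat.succ_pos _)
  rw [Nat.sub_add_cancel hpos, IsIdempotentElem, ← pow_add]
  exact step (i + 1) _ (by nlinarith)

instance WithOne.finite_of_finite : Finite (WithOne S) := inferInstanceAs (Finite (Option S))

/-- Stability of finite semigroups, for left ideals. -/
theorem classL_eq_of_mem {x y : S} (h : y ∈ leftIdeal x) (h' : x ∈ principalIdeal y) :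
    classL y = classL x := by
  refine classL_eq_iff.2 ⟨h, ?_⟩
  obtain ⟨s, hs⟩ := h
  obtain ⟨p, q, hpq⟩ := h'
  rw [hs, ← mul_assoc] at hpq
  -- Iterating `x = (p s) x q` shows that an idempotent power of `p s` fixes `x`. The exponent being
  -- positive, its last factor `s` turns `x` into `y`.
  obtain ⟨n, hn⟩ := exists_pow_isIdempotentElem_of_finite (p * s)
  have key : ∀ k : ℕ, (x : WithOne S) = (p * s) ^ k * x * q ^ k := by
    intro k
    induction k with
    | zero => simp
    | succ k ih =>
      calc (x : WithOne S) = p * s * x * q := hpq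
        _ = p * s * ((p * s) ^ k * x * q ^ k) * q := by rw [← ih]
        _ = (p * s) ^ (k + 1) * x * q ^ (k + 1) := by
          rw [pow_succ', pow_succ]; simp only [mul_assoc]
  have h2 : (p * s) ^ (n + 1) * (x : WithOne S) = x := by
    rw [key (n + 1), ← mul_assoc, ← mul_assoc, hn.eq]
  refine ⟨(p * s) ^ n * p, ?_⟩
  rw [hs]
  calc (x : WithOne S) = (p * s) ^ (n + 1) * x := h2.symm
    _ = _ := by rw [pow_succ]; simp only [mul_assoc]

/-- Stability of finite semigroups, for right ideals. -/
theorem classR_eq_of_mem {x y : S} (h : y ∈ rightIdeal x) (h' : x ∈ principalIdeal y) :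
    classR y = classR x := by
  refine classR_eq_iff.2 ⟨h, ?_⟩
  obtain ⟨s, hs⟩ := h
  obtain ⟨p, q, hpq⟩ := h'
  rw [hs, ← mul_assoc, mul_assoc] at hpq
  obtain ⟨n, hn⟩ := exists_pow_isIdempotentElem_of_finite (s * q)
  have key : ∀ k : ℕ, (x : WithOne S) = p ^ k * x * (s * q) ^ k := by
    intro k
    induction k with
    | zero => simp
    | succ k ih =>
      calc (x : WithOne S) = p * x * (s * q) := hpq
        _ = p * (p ^ k * x * (s * q) ^ k) * (s * q) := by rw [← ih]
        _ = p ^ (k + 1) * x * (s * q) ^ (k + 1) := by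
          rw [pow_succ', pow_succ]; simp only [mul_assoc]
  have h2 : (x : WithOne S) * (s * q) ^ (n + 1) = x := by
    rw [key (n + 1), mul_assoc, hn.eq]
  refine ⟨q * (s * q) ^ n, ?_⟩
  rw [hs]
  calc (x : WithOne S) = x * (s * q) ^ (n + 1) := h2.symm
    _ = _ := by rw [pow_succ']; simp only [mul_assoc]

/-- The theorem of Clifford and Miller on the location of products. -/
theorem classJ_mul_eq_iff {x y : S} (hxy : classJ x = classJ y) :
    classJ (y * x) = classJ x ↔
      ∃ e : S, IsIdempotentElem e ∧ classR e = classR x ∧ classL e = classL y := by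
  constructor
  · intro h
    have hJ := classJ_eq_iff.1 h
    obtain ⟨r, hr⟩ := (classL_eq_iff.1 (classL_eq_of_mem (y := y * x) ⟨y, by simp⟩ hJ.2)).2
    have hJ' := classJ_eq_iff.1 (h.trans hxy)
    obtain ⟨t, ht⟩ := (classR_eq_iff.1 (classR_eq_of_mem (y := y * x) ⟨x, by simp⟩ hJ'.2)).2
    rw [WithOne.coe_mul] at hr ht
    -- Stability has given `x = r y x` and `y = y x t`, so `x t = r y x t = r y`. This element is a
    -- left identity for `x` and a right identity for `y`.
    obtain ⟨e, he⟩ := WithOne.exists_coe_eq_coe_mul x t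
    have he' : (e : WithOne S) = r * y := by
      rw [he]
      conv_rhs => rw [ht]
      conv_lhs => rw [hr]
      simp only [mul_assoc]
    have hex : (x : WithOne S) = e * x := by rw [he', mul_assoc]; exact hr
    have hye : (y : WithOne S) = y * e := by rw [he, ← mul_assoc]; exact ht
    refine ⟨e, ?_, classR_eq_iff.2 ⟨⟨t, he⟩, ⟨x, hex⟩⟩, classL_eq_iff.2 ⟨⟨r, he'⟩, ⟨y, hye⟩⟩⟩
    apply WithOne.coe_injective
    calc ((e * e : S) : WithOne S) = r * y * e := by rw [WithOne.coe_mul, ← he']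
      _ = e := by rw [mul_assoc, ← hye, he']
  · rintro ⟨e, he, hR, hL⟩
    obtain ⟨t, ht⟩ := (classR_eq_iff.1 hR).1
    obtain ⟨r, hr⟩ := (classL_eq_iff.1 hL).1
    have h1 : e ∈ principalIdeal (y * x) := by
      refine ⟨r, t, ?_⟩
      rw [WithOne.coe_mul]
      calc (e : WithOne S) = e * e := by rw [← WithOne.coe_mul, he.eq]
        _ = r * y * (x * t) := by rw [← hr, ← ht]
        _ = _ := by simp only [mul_assoc]
    have h2 : x ∈ principalIdeal e :=
      rightIdeal_subset_principalIdeal e (classR_eq_iff.1 hR).2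
    exact classJ_eq_iff.2 ⟨mul_left_mem_principalIdeal x y, principalIdeal_trans h2 h1⟩

/-- An element of `J` sends each `L`-class of `J` out of `J` or to its own `L`-class. -/
theorem mulL_eq_classL {b : Quotient (greenL S)} {s : S} (h : jOfL (mulL b s) = classJ s) :
    mulL b s = classL s := by
  induction b using Quotient.inductionOn with
  | h x =>
    exact classL_eq_of_mem ⟨x, by simp⟩ (classJ_eq_iff.1 (show classJ (x * s) = classJ s from h)).2

/-- The elements of a regular `J`-class act transitively on its `L`-classes. -/
theorem exists_mulL_eq (J : RegularJClass S) (b b' : LClasses J) :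
    ∃ s : S, classJ s = J.1 ∧ mulL b.1 s = b'.1 := by
  obtain ⟨j, e, he, rfl⟩ := J
  obtain ⟨b, hb⟩ := b
  obtain ⟨b', hb'⟩ := b'
  induction b using Quotient.inductionOn with
  | h x =>
  induction b' using Quotient.inductionOn with
  | h y =>
    have hx : classJ x = classJ e := hb
    have hy : classJ y = classJ e := hb'
    obtain ⟨p, q, hpq⟩ := (classJ_eq_iff.1 hx).2
    obtain ⟨c, d, hcd⟩ := (classJ_eq_iff.1 hy).1
    -- The witness is `s = q e d`: since `e = e e` and `e = p x q`, one gets `y = c e d = c p (x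
    -- s)`, and the factor `e` keeps `s` below `J`.
    obtain ⟨s₁, hs₁⟩ := WithOne.exists_coe_eq_mul_coe q e
    obtain ⟨s, hs⟩ := WithOne.exists_coe_eq_coe_mul s₁ d
    rw [hs₁] at hs
    have hyx : (y : WithOne S) = c * p * ((x * s : S) : WithOne S) := by
      rw [WithOne.coe_mul, hs]
      calc (y : WithOne S) = c * e * d := hcd
        _ = c * (e * e) * d := by rw [← WithOne.coe_mul, he.eq]
        _ = c * (p * x * q * e) * d := by rw [← hpq]
        _ = _ := by simp only [mul_assoc]
    have hxs : y ∈ principalIdeal (x * s) := leftIdeal_subset_principalIdeal _ ⟨_, hyx⟩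
    have hse : s ∈ principalIdeal e := ⟨q, d, hs⟩
    have hey : e ∈ principalIdeal y := (classJ_eq_iff.1 hy).2
    refine ⟨s, ?_, ?_⟩
    · exact classJ_eq_iff.2 ⟨hse, principalIdeal_trans hey
        (principalIdeal_trans hxs (mul_left_mem_principalIdeal s x))⟩
    · refine (classL_eq_of_mem ⟨_, hyx⟩ ?_).symm
      exact principalIdeal_trans (principalIdeal_trans (mul_left_mem_principalIdeal s x) hse) hey

/-- If right multiplication by `s` keeps the `L`-class `b` in its `J`-class, then it maps `b` onto
the `L`-class `b s`. -/
theorem exists_mul_eq_of_classL_eq {x y s : S} (h : classJ (x * s) = classJ x)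
    (hy : classL y = classL (x * s)) : ∃ z : S, classL z = classL x ∧ z * s = y := by
  obtain ⟨c, hc⟩ := (classL_eq_iff.1 hy).1
  obtain ⟨z, hz⟩ := WithOne.exists_coe_eq_mul_coe c x
  have hzs : z * s = y := by
    apply WithOne.coe_injective
    rw [hc, WithOne.coe_mul, WithOne.coe_mul, hz, mul_assoc]
  refine ⟨z, classL_eq_of_mem ⟨c, hz⟩ ?_, hzs⟩
  have h1 : x * s ∈ principalIdeal y :=
    leftIdeal_subset_principalIdeal _ (classL_eq_iff.1 hy).2
  refine principalIdeal_trans (classJ_eq_iff.1 h).2 (principalIdeal_trans h1 ?_)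
  rw [← hzs]
  exact mul_right_mem_principalIdeal z s

end GreenLemmas

section ModuleLemmas

/-! ### Congruences and homomorphisms of right modules. -/

namespace RightModule

variable {k : Type*} [CommSemiring k] {A : Type*} [NonUnitalSemiring A] [Module k A]
variable {M : Type*} [AddCommMonoid M] [Module k M] {N : Type*} [AddCommMonoid N] [Module k N]
variable {ρ : RightModule k A M} {σ : RightModule k A N}

namespace Congruence

theorem ext_of_rel {R T : Congruence ρ} (h : ∀ x y, R.r x y ↔ T.r x y) : R = T := by
  obtain ⟨⟨R, hR⟩, hR'⟩ := R
  obtain ⟨⟨T, hT⟩, hT'⟩ := T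
  obtain rfl : R = T := AddCon.ext h
  rfl

/-- The quotient map as a linear map. -/
def mkHom (R : Congruence ρ) : M →ₗ[k] R.Quot where
  toFun := R.toQuot
  map_add' _ _ := rfl
  map_smul' _ _ := rfl

theorem mkHom_surjective (R : Congruence ρ) : Function.Surjective R.mkHom :=
  Quotient.mk_surjective

theorem mkHom_eq_iff (R : Congruence ρ) {x y : M} : R.mkHom x = R.mkHom y ↔ R.r x y :=
  Quotient.eq (r := R.toSetoid)

theorem isHom_mkHom (R : Congruence ρ) : IsHom ρ R.quotient R.mkHom := fun _ _ => rfl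

/-- The congruence class of `0` as a submodule. -/
def zeroClass (R : Congruence ρ) : Submodule k M := LinearMap.ker R.mkHom

theorem mem_zeroClass (R : Congruence ρ) {x : M} : x ∈ R.zeroClass ↔ R.r x 0 :=
  R.mkHom_eq_iff (y := 0)

theorem IsProper.zeroClass_ne_top {R : Congruence ρ} (h : R.IsProper) : R.zeroClass ≠ ⊤ := by
  obtain ⟨x, y, hxy⟩ := h
  intro htop
  have hz : ∀ z, R.r z 0 := fun z => R.mem_zeroClass.1 (htop ▸ Submodule.mem_top)
  exact hxy (R.iseqv.trans (hz x) (R.iseqv.symm (hz y)))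

/-- The preimage of a congruence under a homomorphism. -/
def comap (f : M →ₗ[k] N) (hf : IsHom ρ σ f) (R : Congruence σ) : Congruence ρ where
  r x y := R.r (f x) (f y)
  iseqv := ⟨fun _ => R.iseqv.refl _, fun h => R.iseqv.symm h, fun h h' => R.iseqv.trans h h'⟩
  add' := by
    intro x x' y y' h h'
    rw [map_add, map_add]
    exact R.add' h h'
  smul := by
    intro c x y h
    rw [map_smul, map_smul]
    exact R.smul c h
  act_compat := by
    intro a x y h
    rw [hf, hf]
    exact R.act_compat a h

/-- The equality congruence. -/
def bot (σ : RightModule k A N) : Congruence σ where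
  r x y := x = y
  iseqv := ⟨fun _ => rfl, Eq.symm, Eq.trans⟩
  add' := by rintro x _ y _ rfl rfl; rfl
  smul := by rintro c x _ rfl; rfl
  act_compat := by rintro a x _ rfl; rfl

/-- The kernel congruence of a homomorphism. -/
def ker (f : M →ₗ[k] N) (hf : IsHom ρ σ f) : Congruence ρ := (bot σ).comap f hf

end Congruence

theorem isSubmodule_comap {f : M →ₗ[k] N} (hf : IsHom ρ σ f) {P : Submodule k N}
    (hP : σ.IsSubmodule P) : ρ.IsSubmodule (P.comap f) := by
  intro m hm a
  rw [Submodule.mem_comap, hf]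
  exact hP _ hm a

theorem isSubmodule_range {f : M →ₗ[k] N} (hf : IsHom ρ σ f) :
    σ.IsSubmodule (LinearMap.range f) := by
  rintro _ ⟨m, rfl⟩ a
  exact ⟨ρ.act m a, hf m a⟩

theorem isSubmodule_bot : ρ.IsSubmodule ⊥ := by
  intro m hm a
  rw [Submodule.mem_bot] at hm ⊢
  rw [hm]
  exact map_zero (ρ a).unop

theorem isSubmodule_ker {f : M →ₗ[k] N} (hf : IsHom ρ σ f) : ρ.IsSubmodule (LinearMap.ker f) :=
  isSubmodule_comap hf isSubmodule_bot

theorem Isomorphic.symm (h : ρ.Isomorphic σ) : σ.Isomorphic ρ := by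
  obtain ⟨f, hf⟩ := h
  refine ⟨f.symm, fun n a => ?_⟩
  have := hf (f.symm n) a
  simp only [LinearEquiv.coe_coe, LinearEquiv.apply_symm_apply] at this ⊢
  rw [← this, LinearEquiv.symm_apply_apply]

/-- The isomorphism theorem. -/
theorem isomorphic_quotient {f : M →ₗ[k] N} (hf : IsHom ρ σ f) (hs : Function.Surjective f)
    (R : Congruence ρ) (hR : ∀ x y, R.r x y ↔ f x = f y) : σ.Isomorphic R.quotient := by
  let g : R.Quot →ₗ[k] N :=
    { toFun := Quotient.lift f fun x y h => (hR x y).1 h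
      map_add' := by
        rintro ⟨x⟩ ⟨y⟩
        exact map_add f x y
      map_smul' := by
        rintro c ⟨x⟩
        exact map_smul f c x }
  have hg : Function.Bijective g := by
    constructor
    · rintro ⟨x⟩ ⟨y⟩ h
      exact Quotient.sound ((hR x y).2 h)
    · intro n
      obtain ⟨m, rfl⟩ := hs n
      exact ⟨R.toQuot m, rfl⟩
  refine Isomorphic.symm ⟨LinearEquiv.ofBijective g hg, ?_⟩
  rintro ⟨x⟩ a
  exact hf x a

/-- Over a semiring this does not make `f` injective; it says only that no nonzero element is sent
to 0. -/
theorem IsMinimal.ker_eq_bot (h : ρ.IsMinimal) {f : M →ₗ[k] N} (hf : IsHom ρ σ f) (hne : f ≠ 0) :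
    LinearMap.ker f = ⊥ :=
  (h.2 _ (isSubmodule_ker hf)).resolve_right fun h' => hne (LinearMap.ker_eq_top.1 h')

theorem IsMinimal.surjective (h : σ.IsMinimal) {f : M →ₗ[k] N} (hf : IsHom ρ σ f) (hne : f ≠ 0) :
    Function.Surjective f :=
  LinearMap.range_eq_top.1 <|
    (h.2 _ (isSubmodule_range hf)).resolve_left fun h' => hne (LinearMap.range_eq_bot.1 h')

end RightModule

/-! ### Minimal boolean modules and their apexes. -/

namespace BoolModule

open RightModule

variable {S : Type u} [Semigroup S]
variable {M : Type v} [AddCommMonoid M] [Module BoolSemiring M]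
variable {N : Type w} [AddCommMonoid N] [Module BoolSemiring N]
variable {ρ : BoolModule S M} {σ : BoolModule S N}

theorem boolAdd_self (x : M) : x + x = x := by
  have h := add_smul (1 : BoolSemiring) 1 x
  rw [BoolSemiring.one_add_one, one_smul] at h
  exact h.symm

theorem sact_sact (ρ : BoolModule S M) (m : M) (s t : S) :
    ρ.sact (ρ.sact m s) t = ρ.sact m (s * t) := by
  simp only [sact]
  rw [← act_mul, MonoidAlgebra.single_mul_single, one_mul]

theorem zero_sact (ρ : BoolModule S M) (s : S) : ρ.sact 0 s = 0 := zero_act ρ _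

/-- The action of a semigroup element as a linear map. -/
noncomputable def sactHom (ρ : BoolModule S M) (s : S) : M →ₗ[BoolSemiring] M :=
  (ρ (MonoidAlgebra.single s 1)).unop

theorem sactHom_apply (ρ : BoolModule S M) (s : S) (m : M) : ρ.sactHom s m = ρ.sact m s := rfl

/-- The action of the algebra is determined by that of the semigroup. -/
theorem act_induction (ρ : BoolModule S M) (m : M) {p : M → MonoidAlgebra BoolSemiring S → Prop}
    (h0 : p 0 0) (hadd : ∀ x y a b, p x a → p y b → p (x + y) (a + b))
    (hs : ∀ s, p (ρ.sact m s) (MonoidAlgebra.single s 1)) (a : MonoidAlgebra BoolSemiring S) :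
    p (ρ.act m a) a := by
  induction a using MonoidAlgebra.induction_linear with
  | zero => rwa [act_zero]
  | add a b ha hb => rw [act_add]; exact hadd _ _ _ _ ha hb
  | single t c =>
    rcases zero_or_one c with rfl | rfl
    · rwa [MonoidAlgebra.single_zero, act_zero]
    · exact hs t

theorem isSubmodule_of_sact {P : Submodule BoolSemiring M} (h : ∀ m ∈ P, ∀ s, ρ.sact m s ∈ P) :
    ρ.IsSubmodule P := fun m hm a =>
  ρ.act_induction m (p := fun x _ => x ∈ P) P.zero_mem (fun _ _ _ _ => P.add_mem) (h m hm) a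

theorem isHom_of_sact {f : M →ₗ[BoolSemiring] N} (h : ∀ m s, f (ρ.sact m s) = σ.sact (f m) s) :
    IsHom ρ σ f := fun m a =>
  ρ.act_induction m (p := fun x a => f x = σ.act (f m) a) (by rw [map_zero, act_zero])
    (fun _ _ _ _ hx hy => by rw [map_add, act_add, hx, hy]) (h m) a

theorem exists_sact_ne_zero (h : ρ.IsNonNull) : ∃ m s, ρ.sact m s ≠ 0 := by
  obtain ⟨m, a, hma⟩ := h
  by_contra! hc
  exact hma (ρ.act_induction m (p := fun x _ => x = 0) rfl
    (fun _ _ _ _ hx hy => by rw [hx, hy, add_zero]) (hc m) a)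

/-- If a right ideal does not annihilate a minimal module then its translates span. -/
theorem sact_eq_zero_of_forall_mul (hρ : ρ.IsMinimal) {T : Set S}
    (hT : ∀ t ∈ T, ∀ s, t * s ∈ T) {m₀ : M} {t₀ : S} (ht₀ : t₀ ∈ T) (hne : ρ.sact m₀ t₀ ≠ 0)
    {s : S} (h : ∀ m, ∀ t ∈ T, ρ.sact m (t * s) = 0) (m : M) : ρ.sact m s = 0 := by
  let P : Submodule BoolSemiring M := Submodule.span BoolSemiring {x | ∃ m, ∃ t ∈ T, ρ.sact m t = x}
  have hP : ρ.IsSubmodule P := by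
    refine isSubmodule_of_sact fun m hm r => ?_
    have hle : P ≤ P.comap (ρ.sactHom r) := by
      refine Submodule.span_le.2 ?_
      rintro _ ⟨m, t, ht, rfl⟩
      exact Submodule.subset_span ⟨m, t * r, hT t ht r, (ρ.sact_sact m t r).symm⟩
    exact hle hm
  -- The span of `M T` is a submodule, as `T` is a right ideal, and it contains `m₀ t₀ ≠ 0`. It is
  -- therefore all of `M`, and `s` kills its generators.
  have htop : P = ⊤ := (hρ.2 P hP).resolve_left fun hbot =>
    hne ((Submodule.eq_bot_iff P).1 hbot _ (Submodule.subset_span ⟨m₀, t₀, ht₀, rfl⟩))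
  have hle : P ≤ LinearMap.ker (ρ.sactHom s) := by
    refine Submodule.span_le.2 ?_
    rintro _ ⟨m, t, ht, rfl⟩
    exact (ρ.sact_sact m t s).trans (h m t ht)
  exact hle (htop ▸ Submodule.mem_top : m ∈ P)

theorem nullCongruence_isProper (hρ : ρ.IsNonNull) : (nullCongruence ρ).IsProper := by
  obtain ⟨m₀, s₀, hne⟩ := exists_sact_ne_zero hρ
  exact ⟨m₀, 0, fun h => hne ((h s₀).2 (ρ.zero_sact s₀))⟩

theorem zeroClass_eq_bot (hρ : ρ.IsMinimal) {R : Congruence ρ} (hR : R.IsProper) :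
    R.zeroClass = ⊥ :=
  (hρ.2 _ (isSubmodule_ker R.isHom_mkHom)).resolve_right hR.zeroClass_ne_top

theorem rel_zero_iff (hρ : ρ.IsMinimal) {R : Congruence ρ} (hR : R.IsProper) {x : M} :
    R.r x 0 ↔ x = 0 := by
  rw [← R.mem_zeroClass, zeroClass_eq_bot hρ hR, Submodule.mem_bot]

/-- Every proper congruence of a minimal module is contained in `≡`. -/
theorem le_nullCongruence (hρ : ρ.IsMinimal) {R : Congruence ρ} (hR : R.IsProper) {x y : M}
    (h : R.r x y) : (nullCongruence ρ).r x y := by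
  intro s
  have hs : R.r (ρ.sact x s) (ρ.sact y s) := R.act_compat _ h
  rw [← rel_zero_iff hρ hR, ← rel_zero_iff hρ hR]
  exact ⟨fun h' => R.iseqv.trans (R.iseqv.symm hs) h', fun h' => R.iseqv.trans hs h'⟩

theorem isMaximal_iff (hρ : ρ.IsMinimal) (R : Congruence ρ) :
    R.IsMaximal ↔ R = nullCongruence ρ := by
  constructor
  · rintro ⟨hR, hmax⟩
    exact (hmax _ (nullCongruence_isProper hρ.1) fun _ _ h => le_nullCongruence hρ hR h).symm
  · rintro rfl
    exact ⟨nullCongruence_isProper hρ.1, fun T hT hle => Congruence.ext_of_rel fun x y =>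
      ⟨fun h => le_nullCongruence hρ hT h, hle x y⟩⟩

/-- Only 0 is congruent to 0, so nonzero products survive in the quotient; submodules of the
quotient pull back to `M`. -/
theorem isMinimal_quotient (hρ : ρ.IsMinimal) {R : Congruence ρ} (hR : R.IsProper) :
    R.quotient.IsMinimal := by
  constructor
  · obtain ⟨m, a, hma⟩ := hρ.1
    refine ⟨R.mkHom m, a, fun h => hma ?_⟩
    rw [← rel_zero_iff hρ hR, ← R.mem_zeroClass]
    exact h
  · intro P hP
    rcases hρ.2 _ (isSubmodule_comap R.isHom_mkHom hP) with h | h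
    · refine Or.inl ((Submodule.eq_bot_iff P).2 fun x hx => ?_)
      obtain ⟨m, rfl⟩ := R.mkHom_surjective x
      have hm : m ∈ P.comap R.mkHom := hx
      rw [h, Submodule.mem_bot] at hm
      rw [hm, map_zero]
    · refine Or.inr (eq_top_iff.2 fun x _ => ?_)
      obtain ⟨m, rfl⟩ := R.mkHom_surjective x
      have hm : m ∈ P.comap R.mkHom := h ▸ Submodule.mem_top
      exact hm

/-- A proper congruence on the quotient pulls back to a proper congruence on `M`, which `≡`
contains. -/
theorem isIrreducible_quotient_nullCongruence (hρ : ρ.IsMinimal) :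
    (nullCongruence ρ).quotient.IsIrreducible := by
  have hmin := isMinimal_quotient hρ (nullCongruence_isProper hρ.1)
  refine ⟨⟨hmin.1, fun R hR x y hxy => ?_⟩, hmin⟩
  obtain ⟨m, rfl⟩ := (nullCongruence ρ).mkHom_surjective x
  obtain ⟨n, rfl⟩ := (nullCongruence ρ).mkHom_surjective y
  have hR' : (R.comap _ (nullCongruence ρ).isHom_mkHom).IsProper := by
    obtain ⟨x, y, hne⟩ := hR
    obtain ⟨m, rfl⟩ := (nullCongruence ρ).mkHom_surjective x
    obtain ⟨n, rfl⟩ := (nullCongruence ρ).mkHom_surjective y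
    exact ⟨m, n, hne⟩
  exact (nullCongruence ρ).mkHom_eq_iff.2 (le_nullCongruence hρ hR' hxy)

theorem map_eq_zero_iff_of_isMinimal (hρ : ρ.IsMinimal) {f : M →ₗ[BoolSemiring] N}
    (hf : IsHom ρ σ f) (hne : f ≠ 0) {x : M} : f x = 0 ↔ x = 0 := by
  rw [← LinearMap.mem_ker, IsMinimal.ker_eq_bot hρ hf hne, Submodule.mem_bot]

/-- A nonzero homomorphism from a minimal module preserves and reflects `≡`. -/
theorem nullCongruence_rel_map_iff (hρ : ρ.IsMinimal) {f : M →ₗ[BoolSemiring] N}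
    (hf : IsHom ρ σ f) (hne : f ≠ 0) {x y : M} :
    (nullCongruence σ).r (f x) (f y) ↔ (nullCongruence ρ).r x y := by
  -- A nonzero homomorphism from a minimal module sends only 0 to 0, so it preserves annihilators.
  have hsact : ∀ z s, σ.sact (f z) s = 0 ↔ ρ.sact z s = 0 := fun z s => by
    rw [← map_eq_zero_iff_of_isMinimal hρ hf hne, show f (ρ.sact z s) = σ.sact (f z) s from hf z _]
  exact forall_congr' fun s => by rw [hsact, hsact]

theorem HasApex.of_isomorphic {J : RegularJClass S} (h : HasApex ρ J) (hi : ρ.Isomorphic σ) :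
    HasApex σ J := by
  obtain ⟨f, hf⟩ := hi
  rw [HasApex, ← (show _ = _ from h)]
  ext s
  constructor
  · intro hs m
    have h1 : f (ρ.sact m s) = σ.sact (f m) s := hf m _
    rw [hs (f m)] at h1
    exact (LinearEquiv.map_eq_zero_iff f).1 h1
  · intro hs n
    have h1 : f (ρ.sact (f.symm n) s) = σ.sact (f (f.symm n)) s := hf _ _
    rw [hs, map_zero, LinearEquiv.apply_symm_apply] at h1
    exact h1.symm

theorem HasApex.exists_sact_ne_zero_iff {J : RegularJClass S} (h : HasApex ρ J) {x : S}
    (hx : classJ x = J.1) {s : S} : (∃ m, ρ.sact m s ≠ 0) ↔ x ∈ principalIdeal s := by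
  have h1 := congrArg (fun T : Set S => s ∈ T) (show _ = _ from h)
  simp only [Set.mem_ofPred_eq, ← hx, setOf_classJ_subset_iff] at h1
  rw [← not_iff_not, ← h1]
  simp

/-- Representatives of the two classes do not annihilate the module, so each lies above the other.
-/
theorem HasApex.unique {J J' : RegularJClass S} (h : HasApex ρ J) (h' : HasApex ρ J') :
    J = J' := by
  obtain ⟨x, hx⟩ := Quotient.exists_rep J.1
  obtain ⟨y, hy⟩ := Quotient.exists_rep J'.1
  have key : ∀ s, x ∈ principalIdeal s ↔ y ∈ principalIdeal s := fun s => by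
    rw [← h.exists_sact_ne_zero_iff hx, h'.exists_sact_ne_zero_iff hy]
  apply Subtype.ext
  rw [← hx, ← hy]
  exact classJ_eq_iff.2
    ⟨(key y).2 (mem_principalIdeal_self y), (key x).1 (mem_principalIdeal_self x)⟩

/-- Every minimal module over a finite semigroup has an apex. -/
theorem exists_hasApex [Finite S] (hρ : ρ.IsMinimal) : ∃ J : RegularJClass S, HasApex ρ J := by
  obtain ⟨m₀, s₀, hne₀⟩ := exists_sact_ne_zero hρ.1
  -- By this choice of `s`, every element of `principalIdeal s` that does not annihilate `M` is
  -- `J`-equivalent to `s`.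
  obtain ⟨s, ⟨m₁, hm₁⟩, hmin⟩ := Set.exists_min_image {s : S | ∃ m, ρ.sact m s ≠ 0}
    (fun s => (principalIdeal s).ncard) (Set.toFinite _) ⟨s₀, m₀, hne₀⟩
  have hclass : ∀ t ∈ principalIdeal s, ∀ m, ρ.sact m t ≠ 0 → classJ t = classJ s := by
    intro t ht m hm
    refine Quotient.sound (s := greenJ S) ?_
    exact Set.eq_of_subset_of_ncard_le (principalIdeal_subset ht) (hmin t ⟨m, hm⟩) (Set.toFinite _)
  have hT : ∀ t ∈ principalIdeal s, ∀ r, t * r ∈ principalIdeal s := fun t ht r =>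
    principalIdeal_trans (mul_right_mem_principalIdeal t r) ht
  have hann : ∀ r, (∃ m, ρ.sact m r ≠ 0) → ∃ m, ∃ t ∈ principalIdeal s, ρ.sact m (t * r) ≠ 0 := by
    rintro r ⟨m, hm⟩
    by_contra! hc
    exact hm (sact_eq_zero_of_forall_mul hρ hT (mem_principalIdeal_self s) hm₁ hc m)
  -- Taking `r = s` yields `t` with both `t` and `t s` in the `J`-class of `s`; Clifford–Miller then
  -- gives an idempotent there.
  obtain ⟨m, t, ht, hm⟩ := hann s ⟨m₁, hm₁⟩
  have hts : classJ t = classJ s := by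
    refine hclass t ht m fun h0 => hm ?_
    rw [← sact_sact, h0, zero_sact]
  obtain ⟨e, he, heR, -⟩ := (classJ_mul_eq_iff hts.symm).1 (hclass (t * s) (hT t ht s) m hm)
  refine ⟨⟨classJ s, e, he, congrArg jOfR heR⟩, ?_⟩
  ext r
  simp only [Set.mem_ofPred_eq, setOf_classJ_subset_iff]
  rw [← not_iff_not, not_not, not_forall]
  constructor
  · intro hr
    obtain ⟨m, t, ht, hm⟩ := hann r hr
    exact principalIdeal_trans (classJ_eq_iff.1 (hclass _ (hT t ht r) m hm)).2
      (mul_left_mem_principalIdeal r t)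
  · rintro ⟨x, y, hxy⟩
    by_contra! hc
    apply hm₁
    -- In `s = x r y` either outer factor may be the adjoined identity, which does not act on `M`;
    -- hence four cases.
    rcases x with _ | x
    · rcases y with _ | y
      · obtain rfl : s = r := by
          apply WithOne.coe_injective
          exact hxy.trans ((mul_one _).trans (one_mul _))
        exact hc m₁
      · obtain rfl : s = r * y := by
          apply WithOne.coe_injective
          exact hxy.trans (congrArg (· * (y : WithOne S)) (one_mul (r : WithOne S)))
        rw [← sact_sact, hc, zero_sact]
    · rcases y with _ | y
      · obtain rfl : s = x * r := by
          apply WithOne.coe_injective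
          exact hxy.trans (mul_one _)
        rw [← sact_sact, hc]
      · obtain rfl : s = x * r * y := by
          apply WithOne.coe_injective
          exact hxy
        rw [← sact_sact, ← sact_sact, hc, zero_sact]

end BoolModule

end ModuleLemmas

/-! ### The free module on the `L`-classes of `J` and its quotients. -/

section FreeModule

open RightModule BoolModule

variable {S : Type u} [Semigroup S] (J : RegularJClass S)

theorem sact_freeLModule (m : LClasses J →₀ BoolSemiring) (s : S) :
    (freeLModule J).sact m s = freeAct J s m := by
  have h : freeLModule J (MonoidAlgebra.single s 1) = MulOpposite.op (freeAct J s) := by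
    simp [freeLModule]
  rw [sact, act, h, MulOpposite.unop_op]

theorem sact_rowModule (f : RClasses J → BoolSemiring) (s : S) :
    (rowModule J).sact f s = rowAct J s f := by
  have h : rowModule J (MonoidAlgebra.single s 1) = MulOpposite.op (rowAct J s) := by
    simp [rowModule]
  rw [sact, act, h, MulOpposite.unop_op]

variable {J}

theorem sact_single_of_eq {b b' : LClasses J} {s : S} (h : mulL b.1 s = b'.1) :
    (freeLModule J).sact (Finsupp.single b 1) s = Finsupp.single b' 1 := by
  have h' : jOfL (mulL b.1 s) = J.1 := h ▸ b'.2
  rw [sact_freeLModule, freeAct, Finsupp.linearCombination_single, one_smul, dif_pos h']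
  exact congrArg (fun c => Finsupp.single c 1) (Subtype.ext h)

theorem sact_single_of_ne {b : LClasses J} {s : S} (h : jOfL (mulL b.1 s) ≠ J.1) :
    (freeLModule J).sact (Finsupp.single b 1) s = 0 := by
  rw [sact_freeLModule, freeAct, Finsupp.linearCombination_single, one_smul, dif_neg h]

theorem single_one_ne_zero (b : LClasses J) : Finsupp.single b (1 : BoolSemiring) ≠ 0 := by
  rw [Ne, Finsupp.single_eq_zero]
  decide

theorem sact_single_eq_zero_iff {b : LClasses J} {s : S} :
    (freeLModule J).sact (Finsupp.single b 1) s = 0 ↔ jOfL (mulL b.1 s) ≠ J.1 := by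
  refine ⟨fun h h' => ?_, sact_single_of_ne⟩
  rw [sact_single_of_eq (b' := ⟨_, h'⟩) rfl] at h
  exact single_one_ne_zero _ h

variable (J) in
theorem nonempty_LClasses : Nonempty (LClasses J) := by
  obtain ⟨j, e, -, rfl⟩ := J
  exact ⟨⟨classL e, rfl⟩⟩

theorem exists_eq_single_add {m : LClasses J →₀ BoolSemiring} (hm : m ≠ 0) :
    ∃ b n, m = Finsupp.single b 1 + n := by
  obtain ⟨b, hb⟩ := Finsupp.ne_iff.1 hm
  refine ⟨b, m.erase b, ?_⟩
  have h1 : m b = 1 := (zero_or_one (m b)).resolve_left hb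
  rw [← h1, Finsupp.single_add_erase]

variable (J) in
-- An element above `J` keeps some `L`-class inside `J`; conversely, if `y s` is in `J`, then `s` is
-- above `J`.
theorem freeLModule_hasApex : HasApex (freeLModule J) J := by
  obtain ⟨x, hx⟩ := Quotient.exists_rep J.1
  change classJ x = J.1 at hx
  ext s
  simp only [Set.mem_ofPred_eq, ← hx, setOf_classJ_subset_iff]
  constructor
  · intro h hxs
    obtain ⟨b, hb⟩ := exists_jOfL_mulL_eq J hx hxs
    exact sact_single_eq_zero_iff.1 (h (Finsupp.single b 1)) hb
  · intro hxs m
    induction m using Finsupp.induction_linear with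
    | zero => exact zero_sact _ s
    | add m n hm hn => rw [sact_add, hm, hn, add_zero]
    | single c z =>
      rcases zero_or_one z with rfl | rfl
      · rw [Finsupp.single_zero, zero_sact]
      · refine sact_single_of_ne fun h => hxs ?_
        obtain ⟨c, hc⟩ := c
        induction c using Quotient.inductionOn with
        | h y =>
          have h' : classJ (y * s) = classJ x := h.trans hx.symm
          exact principalIdeal_trans (classJ_eq_iff.1 h').2 (mul_left_mem_principalIdeal s y)

theorem BoolModule.HasApex.quotient {M : Type v} [AddCommMonoid M] [Module BoolSemiring M]
    {ρ : BoolModule S M} (hρ : ρ.IsMinimal) (h : HasApex ρ J) {R : Congruence ρ}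
    (hR : R.IsProper) : HasApex R.quotient J := by
  rw [HasApex, ← (show _ = _ from h)]
  ext s
  constructor
  · intro hs m
    rw [← rel_zero_iff hρ hR]
    exact R.mkHom_eq_iff.1 (hs (R.mkHom m))
  · intro hs x
    obtain ⟨m, rfl⟩ := R.mkHom_surjective x
    exact (congrArg R.mkHom (hs m)).trans (map_zero _)

/-- The linear map `𝔹B → 𝔹^A` that sends each basis vector to the row of the incidence matrix. -/
noncomputable def rowHom (J : RegularJClass S) :
    (LClasses J →₀ BoolSemiring) →ₗ[BoolSemiring] (RClasses J → BoolSemiring) :=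
  Finsupp.linearCombination BoolSemiring (incidenceMatrix J).row

theorem rowHom_single (b : LClasses J) :
    rowHom J (Finsupp.single b 1) = (incidenceMatrix J).row b := by
  rw [rowHom, Finsupp.linearCombination_single, one_smul]

theorem eq_of_eq_one_iff {c d : BoolSemiring} (h : c = 1 ↔ d = 1) : c = d := by
  revert c d
  decide

theorem eq_of_eq_zero_iff {c d : BoolSemiring} (h : c = 0 ↔ d = 0) : c = d := by
  revert c d
  decide

/-- In an idempotent commutative monoid a sum depends only on the set of its summands. -/
theorem sum_image_of_add_self {ι κ M : Type*} [DecidableEq κ] [AddCommMonoid M]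
    (hM : ∀ x : M, x + x = x) (F : Finset ι) (h : ι → κ) (g : κ → M) :
    ∑ y ∈ F.image h, g y = ∑ x ∈ F, g (h x) := by
  classical
  have absorb : ∀ (E : Finset κ) (y : κ), y ∈ E → g y + ∑ z ∈ E, g z = ∑ z ∈ E, g z := by
    intro E y hy
    rw [← Finset.add_sum_erase E g hy, ← add_assoc, hM]
  induction F using Finset.induction_on with
  | empty => simp
  | insert a F ha ih =>
    rw [Finset.image_insert, Finset.sum_insert ha, ← ih]
    by_cases hmem : h a ∈ F.image h
    · rw [Finset.insert_eq_self.2 hmem, absorb _ _ hmem]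
    · rw [Finset.sum_insert hmem]

variable [Finite S]

/-- An element of `J` maps every vector to `0` or to its own `L`-class. -/
theorem sact_eq_zero_or_eq_single {s : S} {b : LClasses J} (hs : classL s = b.1)
    (m : LClasses J →₀ BoolSemiring) :
    (freeLModule J).sact m s = 0 ∨ (freeLModule J).sact m s = Finsupp.single b 1 := by
  induction m using Finsupp.induction_linear with
  | zero => exact Or.inl (zero_sact _ s)
  | add m n hm hn =>
    rw [sact_add]
    rcases hm with hm | hm <;> rcases hn with hn | hn <;> rw [hm, hn] <;> simp [boolAdd_self]
  | single c x =>
    rcases zero_or_one x with rfl | rfl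
    · rw [Finsupp.single_zero, zero_sact]
      exact Or.inl rfl
    · by_cases h : jOfL (mulL c.1 s) = J.1
      · have hs' : classJ s = J.1 := (congrArg jOfL hs).trans b.2
        exact Or.inr (sact_single_of_eq ((mulL_eq_classL (h.trans hs'.symm)).trans hs))
      · exact Or.inl (sact_single_of_ne h)

variable (J) in
-- If `s` in `J` moves `b` to `b'`, then a vector involving `b` goes to 0 or `b'`, and 0 is excluded
-- because boolean sums do not cancel. So each nonzero vector generates the whole basis.
theorem freeLModule_isMinimal : (freeLModule J).IsMinimal := by
  constructor
  · obtain ⟨b⟩ := nonempty_LClasses J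
    obtain ⟨s, -, hs⟩ := exists_mulL_eq J b b
    exact ⟨Finsupp.single b 1, MonoidAlgebra.single s 1, fun h =>
      single_one_ne_zero b ((sact_single_of_eq hs).symm.trans h)⟩
  · intro P hP
    by_cases hbot : P = ⊥
    · exact Or.inl hbot
    · obtain ⟨m, hmP, hm⟩ := (Submodule.ne_bot_iff P).1 hbot
      obtain ⟨b, n, rfl⟩ := exists_eq_single_add hm
      have hsingle : ∀ b', Finsupp.single b' 1 ∈ P := by
        intro b'
        obtain ⟨s, hsJ, hs⟩ := exists_mulL_eq J b b'
        have hsb : classL s = b'.1 := by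
          rw [← hs, mulL_eq_classL]
          rw [hs, hsJ]
          exact b'.2
        rcases sact_eq_zero_or_eq_single hsb (Finsupp.single b 1 + n) with h | h
        · rw [sact_add, BoolSemiring.add_eq_zero, sact_single_of_eq hs] at h
          exact absurd h.1 (single_one_ne_zero b')
        · rw [← h]
          exact hP _ hmP _
      refine Or.inr (eq_top_iff.2 fun x _ => ?_)
      induction x using Finsupp.induction_linear with
      | zero => exact P.zero_mem
      | add x y hx hy => exact P.add_mem (hx trivial) (hy trivial)
      | single c x =>
        rcases zero_or_one x with rfl | rfl
        · rw [Finsupp.single_zero]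
          exact P.zero_mem
        · exact hsingle c

/-- A minimal module with apex `J` is a homomorphic image of `𝔹B`. -/
theorem exists_hom_of_hasApex {M : Type v} [AddCommMonoid M] [Module BoolSemiring M]
    {ρ : BoolModule S M} (h : HasApex ρ J) :
    ∃ f : (LClasses J →₀ BoolSemiring) →ₗ[BoolSemiring] M, IsHom (freeLModule J) ρ f ∧ f ≠ 0 := by
  classical
  have := Fintype.ofFinite S
  obtain ⟨x₀, hx₀⟩ := Quotient.exists_rep J.1
  change classJ x₀ = J.1 at hx₀
  obtain ⟨m, hm⟩ := (h.exists_sact_ne_zero_iff hx₀).2 (mem_principalIdeal_self x₀)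
  let φ : LClasses J → M := fun b => ∑ x : S with classL x = b.1, ρ.sact m x
  let f := Finsupp.linearCombination BoolSemiring φ
  have hf : ∀ b, f (Finsupp.single b 1) = φ b := fun b => by
    rw [Finsupp.linearCombination_single, one_smul]
  have hφ : ∀ b s, ρ.sact (φ b) s = ∑ x : S with classL x = b.1, ρ.sact m (x * s) := by
    intro b s
    rw [← sactHom_apply, map_sum]
    exact Finset.sum_congr rfl fun x _ => ρ.sact_sact m x s
  refine ⟨f, isHom_of_sact fun n s => ?_, fun h0 => ?_⟩
  · induction n using Finsupp.induction_linear with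
    | zero => simp only [zero_sact, map_zero]
    | add x y hx hy => rw [sact_add, map_add, map_add, sact_add, hx, hy]
    | single b z =>
      rcases zero_or_one z with rfl | rfl
      · rw [Finsupp.single_zero]
        simp only [zero_sact, map_zero]
      rw [hf, hφ]
      by_cases hb : jOfL (mulL b.1 s) = J.1
      -- Right multiplication by `s` maps `b` onto `b s`, perhaps not injectively; idempotent
      -- addition absorbs the repetitions.
      · rw [sact_single_of_eq (b' := ⟨_, hb⟩) rfl, hf,
          ← sum_image_of_add_self boolAdd_self _ (fun x => x * s) (ρ.sact m)]
        refine Finset.sum_congr (Finset.ext fun y => ?_) fun _ _ => rfl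
        obtain ⟨b, hbJ⟩ := b
        induction b using Quotient.inductionOn with
        | h x =>
          simp only [Finset.mem_filter, Finset.mem_image, Finset.mem_univ, true_and]
          constructor
          · intro hy
            exact exists_mul_eq_of_classL_eq (x := x) (s := s) (hb.trans hbJ.symm) hy
          · rintro ⟨z, hz, rfl⟩
            exact congrArg (fun c => mulL c s) hz
      · rw [sact_single_of_ne hb, map_zero]
        refine (Finset.sum_eq_zero fun x hx => ?_).symm
        have hxb : classL x = b.1 := (Finset.mem_filter.1 hx).2
        have hxJ : classJ x = J.1 := (congrArg jOfL hxb).trans b.2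
        -- If `m (x s) ≠ 0`, the apex condition puts `x s` above `J`, so `x s` would lie in `J`.
        by_contra hne
        have hmem := (h.exists_sact_ne_zero_iff hxJ).1 ⟨m, hne⟩
        refine hb (Eq.trans ?_ hxJ)
        rw [← hxb]
        exact classJ_eq_iff.2 ⟨mul_right_mem_principalIdeal x s, hmem⟩
  · have h1 : φ ⟨classL x₀, hx₀⟩ = 0 := by rw [← hf, h0, LinearMap.zero_apply]
    have h2 : x₀ ∈ Finset.univ.filter fun x => classL x = classL x₀ := by simp
    have h3 := Finset.add_sum_erase _ (ρ.sact m) h2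
    exact hm (BoolSemiring.add_eq_zero.1 (h3.trans h1)).1

theorem exists_isomorphic_quotient_of_hasApex {M : Type v} [AddCommMonoid M]
    [Module BoolSemiring M] {ρ : BoolModule S M} (hρ : ρ.IsMinimal) (h : HasApex ρ J) :
    ∃ R : Congruence (freeLModule J), R.IsProper ∧ ρ.Isomorphic R.quotient := by
  obtain ⟨f, hf, hne⟩ := exists_hom_of_hasApex h
  refine ⟨Congruence.ker f hf, ?_,
    isomorphic_quotient hf (hρ.surjective hf hne) _ fun _ _ => Iff.rfl⟩
  obtain ⟨x, hx⟩ := DFunLike.ne_iff.1 hne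
  exact ⟨x, 0, fun h => hx (h.trans (map_zero f))⟩

/-- The surjection from `𝔹B` preserves and reflects `≡`, which is equality on a simple module, so
its kernel congruence is `≡`. -/
theorem isomorphic_quotientModule_of_hasApex {M : Type v} [AddCommMonoid M]
    [Module BoolSemiring M] {ρ : BoolModule S M} (hρ : ρ.IsIrreducible) (h : HasApex ρ J) :
    ρ.Isomorphic (quotientModule J) := by
  obtain ⟨f, hf, hne⟩ := exists_hom_of_hasApex h
  refine isomorphic_quotient hf (hρ.2.surjective hf hne) _ fun x y => ?_
  refine (nullCongruence_rel_map_iff (freeLModule_isMinimal J) hf hne).symm.trans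
    ⟨fun hxy => hρ.1.2 _ (nullCongruence_isProper hρ.2.1) _ _ hxy, fun hxy => ?_⟩
  rw [hxy]

/-! ### The rows of the incidence matrix. -/

/-- The incidence matrix records which `R`-class representatives keep an `L`-class in `J`. -/
theorem incidenceMatrix_eq_one_iff {b : LClasses J} {a : RClasses J} {x : S}
    (hx : classR x = a.1) : incidenceMatrix J b a = 1 ↔ jOfL (mulL b.1 x) = J.1 := by
  classical
  obtain ⟨b, hb⟩ := b
  induction b using Quotient.inductionOn with
  | h y =>
    have hxJ : classJ x = J.1 := (congrArg jOfR hx).trans a.2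
    have key := classJ_mul_eq_iff (hxJ.trans (show J.1 = classJ y from hb.symm))
    rw [hx, hxJ] at key
    refine Iff.trans ?_ key.symm
    unfold incidenceMatrix
    split_ifs with h
    · exact iff_of_true rfl h
    · exact iff_of_false not_false h

open Classical in
theorem isHom_rowHom : IsHom (freeLModule J) (rowModule J) (rowHom J) := by
  refine isHom_of_sact fun m s => ?_
  induction m using Finsupp.induction_linear with
  | zero => simp only [zero_sact, map_zero]
  | add x y hx hy => rw [sact_add, map_add, map_add, sact_add, hx, hy]
  | single b z =>
    rcases zero_or_one z with rfl | rfl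
    · rw [Finsupp.single_zero]
      simp only [zero_sact, map_zero]
    funext a
    obtain ⟨x, hx⟩ := Quotient.exists_rep a.1
    change classR x = a.1 at hx
    have hxJ : classJ x = J.1 := (congrArg jOfR hx).trans a.2
    have hmul : mulR s a.1 = classR (s * x) := by rw [← hx]; rfl
    have h01 : (0 : BoolSemiring) ≠ 1 := by decide
    apply eq_of_eq_one_iff
    -- Both entries at `a` test whether `b s x` stays in `J`: one brackets it as `(b s) x`, the
    -- other as `b (s x)`. If `b s` or `s x` has already left `J`, so has the product.
    trans jOfL (mulL b.1 (s * x)) = J.1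
    · by_cases hb : jOfL (mulL b.1 s) = J.1
      · rw [sact_single_of_eq (b' := ⟨_, hb⟩) rfl, rowHom_single, mulL_mul]
        exact incidenceMatrix_eq_one_iff (b := ⟨_, hb⟩) hx
      · rw [sact_single_of_ne hb, map_zero, mulL_mul]
        exact iff_of_false h01 fun h => hb ((jOfL_mulL_of_mul (h.trans b.2.symm)).trans b.2)
    · rw [sact_rowModule, rowHom_single]
      change _ ↔ (if h : jOfR (mulR s a.1) = J.1 then
        incidenceMatrix J b ⟨mulR s a.1, h⟩ else 0) = 1
      split_ifs with h
      · exact (incidenceMatrix_eq_one_iff (a := ⟨_, h⟩) hmul.symm).symm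
      · refine iff_of_false (fun h' => h ?_) not_false
        obtain ⟨b, hb⟩ := b
        induction b using Quotient.inductionOn with
        | h y =>
          rw [hmul]
          exact (classJ_eq_of_mul_left (x := x) (s := y) (t := s) (h'.trans hxJ.symm)).trans hxJ

theorem rowHom_apply_eq_zero_iff {a : RClasses J} {x : S} (hx : classR x = a.1)
    (m : LClasses J →₀ BoolSemiring) : rowHom J m a = 0 ↔ (freeLModule J).sact m x = 0 := by
  induction m using Finsupp.induction_linear with
  | zero => simp [zero_sact]
  | add m n hm hn =>
    rw [map_add, sact_add, BoolSemiring.add_eq_zero, Pi.add_apply, BoolSemiring.add_eq_zero, hm, hn]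
  | single b z =>
    rcases zero_or_one z with rfl | rfl
    · simp [zero_sact]
    · have h01 : ∀ c : BoolSemiring, c = 0 ↔ ¬ c = 1 := by decide
      rw [rowHom_single, sact_single_eq_zero_iff, Matrix.row_apply, h01,
        incidenceMatrix_eq_one_iff hx]

theorem rowHom_ne_zero : rowHom J ≠ 0 := by
  intro h
  obtain ⟨b⟩ := nonempty_LClasses J
  obtain ⟨s, hsJ, hs⟩ := exists_mulL_eq J b b
  have h1 : (freeLModule J).sact (Finsupp.single b 1) s = 0 := by
    rw [← rowHom_apply_eq_zero_iff (a := ⟨classR s, hsJ⟩) rfl, h]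
    rfl
  rw [sact_single_of_eq hs] at h1
  exact single_one_ne_zero b h1

/-- Rows test annihilation only by elements of `J`. That this suffices for all `s` holds because
`rowHom` is a nonzero homomorphism from a minimal module, hence reflects `≡`. -/
theorem rel_freeCongruence_iff {x y : LClasses J →₀ BoolSemiring} :
    (freeCongruence J).r x y ↔ rowHom J x = rowHom J y := by
  constructor
  · intro h
    funext a
    obtain ⟨t, ht⟩ := Quotient.exists_rep a.1
    apply eq_of_eq_zero_iff
    rw [rowHom_apply_eq_zero_iff ht, rowHom_apply_eq_zero_iff ht]
    exact h t
  · intro h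
    refine (nullCongruence_rel_map_iff (freeLModule_isMinimal J) isHom_rowHom rowHom_ne_zero).1 ?_
    rw [h]

variable (J) in
/-- The map `𝔹B/≡ → 𝔹^A` induced by `rowHom`. -/
noncomputable def rowEmbedding :
    (freeCongruence J).Quot →ₗ[BoolSemiring] (RClasses J → BoolSemiring) where
  toFun := Quotient.lift (rowHom J) fun _ _ h => rel_freeCongruence_iff.1 h
  map_add' := by
    rintro ⟨x⟩ ⟨y⟩
    exact map_add (rowHom J) x y
  map_smul' := by
    rintro c ⟨x⟩
    exact map_smul (rowHom J) c x

theorem rowEmbedding_injective : Function.Injective (rowEmbedding J) := by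
  rintro ⟨x⟩ ⟨y⟩ h
  exact Quotient.sound (rel_freeCongruence_iff.2 h)

theorem range_rowEmbedding :
    LinearMap.range (rowEmbedding J) =
      Submodule.span BoolSemiring (Set.range (incidenceMatrix J).row) := by
  rw [← Finsupp.range_linearCombination]
  apply le_antisymm
  · rintro _ ⟨⟨x⟩, rfl⟩
    exact ⟨x, rfl⟩
  · rintro _ ⟨x, rfl⟩
    exact ⟨(freeCongruence J).toQuot x, rfl⟩

theorem isHom_rowEmbedding : IsHom (quotientModule J) (rowModule J) (rowEmbedding J) := by
  rintro ⟨x⟩ a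
  exact isHom_rowHom x a

end FreeModule

theorem mainTheorem5 (S : Type u) [Semigroup S] [Finite S] :
    (∀ J : RegularJClass S,
      -- `≡` is the unique maximal proper congruence on `𝔹B`
      (∀ R : RightModule.Congruence (freeLModule J), R.IsMaximal ↔ R = freeCongruence J) ∧
      -- `𝔹B` is minimal, and so is its quotient by any proper congruence
      (freeLModule J).IsMinimal ∧
      (∀ R : RightModule.Congruence (freeLModule J), R.IsProper → R.quotient.IsMinimal) ∧
      -- `𝔹B/≡` is irreducible, and up to isomorphism the only irreducible module with apex `J`
      (quotientModule J).IsIrreducible ∧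
      BoolModule.HasApex (quotientModule J) J ∧
      (∀ (M : Type v) [AddCommMonoid M] [Module BoolSemiring M] (ρ : BoolModule S M),
        ρ.IsIrreducible → BoolModule.HasApex ρ J → ρ.Isomorphic (quotientModule J)) ∧
      -- `𝔹B/≡` is identified with the span of the rows of `C`, inside the right module `𝔹^A`
      (∃ f : (freeCongruence J).Quot →ₗ[BoolSemiring] (RClasses J → BoolSemiring),
        RightModule.IsHom (quotientModule J) (rowModule J) f ∧
        (∀ b : LClasses J,
          f ((freeCongruence J).toQuot (Finsupp.single b 1)) = (incidenceMatrix J).row b) ∧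
        Function.Injective f ∧
        LinearMap.range f = Submodule.span BoolSemiring (Set.range (incidenceMatrix J).row))) ∧
    -- every irreducible module arises from exactly one regular `J`-class
    (∀ (M : Type v) [AddCommMonoid M] [Module BoolSemiring M] (ρ : BoolModule S M),
      ρ.IsIrreducible → ∃! J : RegularJClass S, ρ.Isomorphic (quotientModule J)) ∧
    -- every minimal module is a proper quotient of some `𝔹B`
    (∀ (M : Type v) [AddCommMonoid M] [Module BoolSemiring M] (ρ : BoolModule S M),
      ρ.IsMinimal → ∃ (J : RegularJClass S) (R : RightModule.Congruence (freeLModule J)),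
        R.IsProper ∧ ρ.Isomorphic R.quotient) := by
  have hapex : ∀ J : RegularJClass S, BoolModule.HasApex (quotientModule J) J := fun J =>
    BoolModule.HasApex.quotient (freeLModule_isMinimal J) (freeLModule_hasApex J)
      (BoolModule.nullCongruence_isProper (freeLModule_isMinimal J).1)
  refine ⟨fun J => ⟨?_, freeLModule_isMinimal J, ?_, ?_, hapex J, ?_, ?_⟩, ?_, ?_⟩
  · exact BoolModule.isMaximal_iff (freeLModule_isMinimal J)
  · exact fun R hR => BoolModule.isMinimal_quotient (freeLModule_isMinimal J) hR
  · exact BoolModule.isIrreducible_quotient_nullCongruence (freeLModule_isMinimal J)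
  · intro M _ _ ρ hρ h
    exact isomorphic_quotientModule_of_hasApex hρ h
  · exact ⟨rowEmbedding J, isHom_rowEmbedding, rowHom_single, rowEmbedding_injective,
      range_rowEmbedding⟩
  · intro M _ _ ρ hρ
    obtain ⟨J, hJ⟩ := BoolModule.exists_hasApex hρ.2
    -- Uniqueness: the apex is an isomorphism invariant, and `J'` is the apex of its own quotient
    -- module.
    exact ⟨J, isomorphic_quotientModule_of_hasApex hρ hJ, fun J' hJ' =>
      (hapex J').unique (hJ.of_isomorphic hJ')⟩
  · intro M _ _ ρ hρ
    obtain ⟨J, hJ⟩ := BoolModule.exists_hasApex hρ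
    exact ⟨J, exists_isomorphic_quotient_of_hasApex hρ hJ⟩
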